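/- Let $\lambda$ be a regular cardinal and let $\mathcal V=(\mathcal V_0,\otimes,I)$ be a symmetric monoidal closed category that is locally $\lambda$-presentable as a closed category: $\mathcal V_0$ is locally $\lambda$-presentable, and its $\lambda$-presentable objects contain $I$ and are closed under $\otimes$. For a regular cardinal $\mu$ let $\mathcal V_\mu$ be the full subcategory of $\mu$-presentable objects, and put $\mathcal V_\infty=\mathcal V$. Write $A^X=[X,A]$ for the internal hom. Let $\mathbb L$ be a $\lambda$-ary language, i.e. a small set of function symbols $f:(X,Y)$ with $X,Y\in\mathcal V_\lambda$. An $\mathbb L$-structure is an object $A$ of $\mathcal V$ with a morphism $f_A:A^X\to A^Y$ for each symbol $f:(X,Y)$; a morphism $A\to B$ is a map $h:A\to B$ in $\mathcal V$ with $h^Y f_A=f_B h^X$ for all $f$. These form a $\mathcal V$-category $\mathrm{Str}(\mathbb L)$, whose hom-object $\mathrm{Str}(\mathbb L)(A,B)$ is the joint equalizer of the maps $[A,B]\rightrightarrows[A^X,B^Y]$, $h\mapsto h^Yf_A$ and $h\mapsto f_Bh^X$, over all $f:(X,Y)$ in $\mathbb L$. A free structure on $X\in\mathcal V$ is a structure $FX$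 with a map $X\to FX$ in $\mathcal V$ inducing isomorphisms $\mathrm{Str}(\mathbb L)(FX,A)\cong A^X$ in $\mathcal V$ for all $A$. An extended term $t:(X,Y)$ is a morphism $t:FY\to FX$ of $\mathbb L$-structures; its interpretation in $A$ is the composite $$t_A: A^X\cong\mathrm{Str}(\mathbb L)(FX,A)\xrightarrow{\ \mathrm{Str}(\mathbb L)(t,A)\ }\mathrm{Str}(\mathbb L)(FY,A)\cong A^Y .$$ For $\lambda\le\kappa\le\infty$ ($\kappa$ a regular cardinal or $\infty$), a $\kappa$-ary equational $\mathbb L$-theory is a collection $\mathbb E$ of equations $(s=t)$ between extended terms of the same arity $(X,Y)$ with $X,Y\in\mathcal V_\kappa$; the class it defines consists of the structures $A$ with $s_A=t_A$ for all equations in $\mathbb E$. A structure $A$ is orthogonal with respect to $h:B\to C$ in $\mathrm{Str}(\mathbb L)$ if $\mathrm{Str}(\mathbb L)(h,A):\mathrm{Str}(\mathbb L)(C,A)\to\mathrm{Str}(\mathbb L)(B,A)$ is an isomorphism in $\mathcal V$. **Proposition.** Every object $X$ of $\mathcal V$ has a free $\mathbb L$-structure $FX$. For any choice of free structures, and for every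 $\lambda\le\kappa\le\infty$, a class of $\mathbb L$-structures is defined by a $\kappa$-ary equational $\mathbb L$-theory if and only if it is the class of all structures orthogonal with respect to some collection of regular epimorphisms $h:FX\twoheadrightarrow W$ in $\mathrm{Str}(\mathbb L)$ with $X\in\mathcal V_\kappa$. This holds when the collections of equations and of morphisms are both allowed to be proper classes, and also when both are required to be small sets; if $\kappa<\infty$, the classes defined by a small set of $\kappa$-ary equations are precisely those given by an arbitrary (possibly large) collection of such regular epimorphisms. -/

import Mathlib

open CategoryTheory Limits MonoidalCategory

universe v u

namespace EnrichedUA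

/-- A locally `κ`-presentable category is complete. -/
theorem hasLimits_of_locallyPresentable (V : Type u) [Category.{v} V] (κ : Cardinal.{v})
    [Fact κ.IsRegular] [IsCardinalLocallyPresentable V κ] : HasLimits V := by
  let S := SmallModel.{v} (isCardinalPresentable V κ).FullSubcategory
  let F : S ⥤ V := (equivSmallModel.{v} (isCardinalPresentable V κ).FullSubcategory).inverse ⋙
    (isCardinalPresentable V κ).ι
  have : F.IsDense := by infer_instance
  let L : (Sᵒᵖ ⥤ Type v) ⥤ V := uliftYoneda.{v}.leftKanExtension F
  let adj : L ⊣ Presheaf.restrictedULiftYoneda.{v} F :=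
    Presheaf.uliftYonedaAdjunction.{v} L (uliftYoneda.{v}.leftKanExtensionUnit F)
  have : Reflective (Presheaf.restrictedULiftYoneda.{v} F) := ⟨L, adj⟩
  exact ⟨fun J _ => hasLimitsOfShape_of_reflective (Presheaf.restrictedULiftYoneda.{v} F)⟩

/-- The monoidal category `V` is locally `κ`-presentable as a closed category: its underlying
category is locally `κ`-presentable, and the `κ`-presentable objects contain the unit and are
closed under the tensor product. (That `V` is symmetric monoidal closed is kept as separate
data.) -/
class IsLocallyPresentableAsClosed (V : Type u) [Category.{v} V] [MonoidalCategory V]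
    (κ : Cardinal.{v}) [Fact κ.IsRegular] : Prop extends IsCardinalLocallyPresentable V κ where
  unit_presentable : IsCardinalPresentable (𝟙_ V) κ
  tensor_presentable (X Y : V) : IsCardinalPresentable X κ → IsCardinalPresentable Y κ →
    IsCardinalPresentable (X ⊗ Y) κ

/-- A (single-sorted, functional) `κ`-ary language over `V`: a small set of function symbols
`f : (X, Y)` whose input arity `X` and output arity `Y` are `κ`-presentable objects of `V`. -/
structure Language (V : Type u) [Category.{v} V] (κ : Cardinal.{v}) [Fact κ.IsRegular] where
  /-- the function symbols -/
  Symb : Type v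
  /-- the input arity -/
  dom : Symb → V
  /-- the output arity -/
  cod : Symb → V
  dom_presentable (f : Symb) : IsCardinalPresentable (dom f) κ
  cod_presentable (f : Symb) : IsCardinalPresentable (cod f) κ

section Structures

variable {V : Type u} [Category.{v} V] [MonoidalCategory V] [MonoidalClosed V]
  {κ : Cardinal.{v}} [Fact κ.IsRegular]

/-- An `L`-structure: an object `A` of `V` together with a morphism `f_A : A ^ X ⟶ A ^ Y` for every
function symbol `f : (X, Y)`, where `A ^ X` is the internal hom `[X, A]`. -/
structure Str (L : Language V κ) where
  /-- the underlying object -/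
  carrier : V
  /-- the interpretation of the function symbols -/
  interp (f : L.Symb) : (ihom (L.dom f)).obj carrier ⟶ (ihom (L.cod f)).obj carrier

namespace Str

variable {L : Language V κ}

/-- A morphism of `L`-structures. -/
@[ext]
structure Hom (A B : Str L) where
  /-- the underlying morphism in `V` -/
  hom : A.carrier ⟶ B.carrier
  comm (f : L.Symb) : A.interp f ≫ (ihom (L.cod f)).map hom =
    (ihom (L.dom f)).map hom ≫ B.interp f

/-- The ordinary category of `L`-structures. -/
instance : Category (Str L) where
  Hom A B := Hom A B
  id A := ⟨𝟙 _, fun f => by simp⟩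
  comp {A B C} g h := ⟨g.hom ≫ h.hom, fun f => by
    rw [Functor.map_comp, Functor.map_comp, ← Category.assoc, g.comm, Category.assoc, h.comm,
      Category.assoc]⟩

@[ext]
theorem hom_ext {A B : Str L} {g h : A ⟶ B} (w : g.hom = h.hom) : g = h := Hom.ext w

@[simp] theorem id_hom (A : Str L) : Hom.hom (𝟙 A) = 𝟙 A.carrier := rfl

@[simp] theorem comp_hom {A B C : Str L} (g : A ⟶ B) (h : B ⟶ C) :
    (g ≫ h).hom = g.hom ≫ h.hom := rfl

end Str

/-- The action `[A, B] ⟶ [A ^ X, B ^ X]` of the `V`-functor `(-) ^ X` on hom-objects. -/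
def powMap (X A B : V) :
    (ihom A).obj B ⟶ (ihom ((ihom X).obj A)).obj ((ihom X).obj B) :=
  MonoidalClosed.curry (MonoidalClosed.comp X A B)

namespace Str

variable {L : Language V κ}

/-- The map `[A, B] ⟶ [A ^ X, B ^ Y]` which is, on elements, `h ↦ h ^ Y ∘ f_A`. -/
def homLeft (A B : Str L) (f : L.Symb) :
    (ihom A.carrier).obj B.carrier ⟶
      (ihom ((ihom (L.dom f)).obj A.carrier)).obj ((ihom (L.cod f)).obj B.carrier) :=
  powMap (L.cod f) A.carrier B.carrier ≫ (MonoidalClosed.pre (A.interp f)).app _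

/-- The map `[A, B] ⟶ [A ^ X, B ^ Y]` which is, on elements, `h ↦ f_B ∘ h ^ X`. -/
def homRight (A B : Str L) (f : L.Symb) :
    (ihom A.carrier).obj B.carrier ⟶
      (ihom ((ihom (L.dom f)).obj A.carrier)).obj ((ihom (L.cod f)).obj B.carrier) :=
  powMap (L.dom f) A.carrier B.carrier ≫ (ihom _).map (B.interp f)

theorem comp_homLeft_eq_iff {A B : Str L} (f : L.Symb) {Z : V}
    (g : Z ⟶ (ihom A.carrier).obj B.carrier) :
    g ≫ homLeft A B f = g ≫ homRight A B f ↔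
      A.interp f ▷ Z ≫ _ ◁ g ≫ MonoidalClosed.comp (L.cod f) A.carrier B.carrier =
        _ ◁ g ≫ MonoidalClosed.comp (L.dom f) A.carrier B.carrier ≫ B.interp f := by
  have hl : g ≫ homLeft A B f = MonoidalClosed.curry (A.interp f ▷ Z ≫ _ ◁ g ≫
      MonoidalClosed.comp (L.cod f) A.carrier B.carrier) := by
    rw [homLeft, powMap, ← Category.assoc, ← MonoidalClosed.curry_natural_left,
      MonoidalClosed.curry_pre_app]
  have hr : g ≫ homRight A B f = MonoidalClosed.curry (_ ◁ g ≫
      MonoidalClosed.comp (L.dom f) A.carrier B.carrier ≫ B.interp f) := by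
    rw [homRight, powMap, ← MonoidalClosed.curry_natural_right,
      ← MonoidalClosed.curry_natural_left]
  rw [hl, hr]
  exact MonoidalClosed.curry_injective.eq_iff

theorem curry'_comp_homLeft_eq_iff {A B : Str L} (f : L.Symb) (h : A.carrier ⟶ B.carrier) :
    MonoidalClosed.curry' h ≫ homLeft A B f = MonoidalClosed.curry' h ≫ homRight A B f ↔
      A.interp f ≫ (ihom (L.cod f)).map h = (ihom (L.dom f)).map h ≫ B.interp f := by
  rw [comp_homLeft_eq_iff, MonoidalClosed.whiskerLeft_curry'_comp,
    MonoidalClosed.whiskerLeft_curry'_comp_assoc, ← cancel_epi (ρ_ _).inv]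
  simp

theorem id_condition (A : Str L) (f : L.Symb) :
    MonoidalClosed.id A.carrier ≫ homLeft A A f = MonoidalClosed.id A.carrier ≫ homRight A A f := by
  rw [← MonoidalClosed.curry'_id, curry'_comp_homLeft_eq_iff]
  simp

variable [IsLocallyPresentableAsClosed V κ]

/-- The hom-object `Str(L)(A, B)`: the joint equalizer in `V` of the maps `h ↦ h ^ Y ∘ f_A` and
`h ↦ f_B ∘ h ^ X` out of `[A, B]`, over all function symbols `f : (X, Y)`. -/
noncomputable def homObj (A B : Str L) : V :=
  haveI := hasLimits_of_locallyPresentable V κ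
  equalizer (Pi.lift (homLeft A B)) (Pi.lift (homRight A B))

/-- The inclusion `Str(L)(A, B) ⟶ [A, B]`: the action of the forgetful `V`-functor. -/
noncomputable def homι (A B : Str L) : homObj A B ⟶ (ihom A.carrier).obj B.carrier :=
  haveI := hasLimits_of_locallyPresentable V κ
  equalizer.ι _ _

instance (A B : Str L) : Mono (homι A B) := by
  have := hasLimits_of_locallyPresentable V κ
  exact equalizer.ι_mono

theorem homι_condition (A B : Str L) (f : L.Symb) :
    homι A B ≫ homLeft A B f = homι A B ≫ homRight A B f := by
  have := hasLimits_of_locallyPresentable V κ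
  have h := equalizer.condition (Pi.lift (homLeft A B)) (Pi.lift (homRight A B))
  simpa using! h =≫ Pi.π _ f

/-- The universal property of `Str(L)(A, B)`. -/
noncomputable def homLift {A B : Str L} {Z : V} (g : Z ⟶ (ihom A.carrier).obj B.carrier)
    (w : ∀ f, g ≫ homLeft A B f = g ≫ homRight A B f) : Z ⟶ homObj A B :=
  haveI := hasLimits_of_locallyPresentable V κ
  equalizer.lift g (Pi.hom_ext _ _ fun f => by simpa using w f)

@[simp]
theorem homLift_ι {A B : Str L} {Z : V} (g : Z ⟶ (ihom A.carrier).obj B.carrier)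
    (w : ∀ f, g ≫ homLeft A B f = g ≫ homRight A B f) : homLift g w ≫ homι A B = g := by
  have := hasLimits_of_locallyPresentable V κ
  exact equalizer.lift_ι _ _

theorem comp_condition (A B C : Str L) (f : L.Symb) :
    ((homι A B ⊗ₘ homι B C) ≫ MonoidalClosed.comp A.carrier B.carrier C.carrier) ≫
        homLeft A C f =
      ((homι A B ⊗ₘ homι B C) ≫ MonoidalClosed.comp A.carrier B.carrier C.carrier) ≫
        homRight A C f := by
  have h₁ := (comp_homLeft_eq_iff f _).1 (homι_condition A B f)
  have h₂ := (comp_homLeft_eq_iff f _).1 (homι_condition B C f)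
  rw [comp_homLeft_eq_iff]
  simp only [MonoidalCategory.whiskerLeft_comp, Category.assoc]
  rw [← MonoidalClosed.assoc, ← MonoidalClosed.assoc_assoc]
  have e (X : V) : X ◁ (homι A B ⊗ₘ homι B C) ≫ (α_ _ _ _).inv =
      (α_ _ _ _).inv ≫ (X ◁ homι A B) ▷ _ ≫ _ ◁ homι B C := by
    simp [MonoidalCategory.tensorHom_def]
  simp only [reassoc_of% e]
  have h₃ := congr($h₁ ▷ homObj B C)
  simp only [comp_whiskerRight] at h₃
  rw [associator_inv_naturality_left_assoc, whisker_exchange_assoc, reassoc_of% h₃,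
    h₂, whisker_exchange_assoc]

/-- The identities of the `V`-category of `L`-structures. -/
noncomputable def homId (A : Str L) : 𝟙_ V ⟶ homObj A A :=
  homLift (MonoidalClosed.id A.carrier) (id_condition A)

@[simp]
theorem homId_ι (A : Str L) : homId A ≫ homι A A = MonoidalClosed.id A.carrier :=
  homLift_ι _ _

/-- The composition of the `V`-category of `L`-structures, restricted from that of `V`. -/
noncomputable def homComp (A B C : Str L) : homObj A B ⊗ homObj B C ⟶ homObj A C :=
  homLift _ (comp_condition A B C)

@[simp]
theorem homComp_ι (A B C : Str L) : homComp A B C ≫ homι A C =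
    (homι A B ⊗ₘ homι B C) ≫ MonoidalClosed.comp A.carrier B.carrier C.carrier :=
  homLift_ι _ _

/-- The `V`-category of `L`-structures; its underlying ordinary category is the one above. -/
noncomputable instance : EnrichedOrdinaryCategory V (Str L) where
  Hom A B := homObj A B
  id A := homId A
  comp A B C := homComp A B C
  id_comp A B := by
    have e : homId A ▷ homObj A B ≫ (homι A A ⊗ₘ homι A B) =
        _ ◁ homι A B ≫ MonoidalClosed.id A.carrier ▷ _ := by
      rw [whisker_exchange, MonoidalCategory.tensorHom_def, ← comp_whiskerRight_assoc, homId_ι]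
    rw [← cancel_mono (homι A B)]
    simp only [Category.assoc, homComp_ι, Category.id_comp, reassoc_of% e]
    rw [← leftUnitor_inv_naturality_assoc]
    simp
  comp_id A B := by
    have e : homObj A B ◁ homId B ≫ (homι A B ⊗ₘ homι B B) =
        homι A B ▷ _ ≫ _ ◁ MonoidalClosed.id B.carrier := by
      rw [← whisker_exchange, MonoidalCategory.tensorHom_def',
        ← MonoidalCategory.whiskerLeft_comp_assoc, homId_ι]
    rw [← cancel_mono (homι A B)]
    simp only [Category.assoc, homComp_ι, Category.id_comp, reassoc_of% e]
    rw [← rightUnitor_inv_naturality_assoc]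
    simp
  assoc A B C D := by
    have e₁ : homComp A B C ▷ homObj C D ≫ (homι A C ⊗ₘ homι C D) =
        ((homι A B ⊗ₘ homι B C) ⊗ₘ homι C D) ≫ MonoidalClosed.comp _ _ _ ▷ _ := by
      rw [MonoidalCategory.tensorHom_def, ← comp_whiskerRight_assoc, homComp_ι,
        MonoidalCategory.tensorHom_def _ (homι C D), comp_whiskerRight_assoc, Category.assoc,
        whisker_exchange]
    have e₂ : homObj A B ◁ homComp B C D ≫ (homι A B ⊗ₘ homι B D) =
        (homι A B ⊗ₘ (homι B C ⊗ₘ homι C D)) ≫ _ ◁ MonoidalClosed.comp _ _ _ := by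
      rw [MonoidalCategory.tensorHom_def', ← MonoidalCategory.whiskerLeft_comp_assoc, homComp_ι,
        MonoidalCategory.tensorHom_def' (homι A B), MonoidalCategory.whiskerLeft_comp_assoc,
        Category.assoc, whisker_exchange]
    rw [← cancel_mono (homι A D)]
    simp only [Category.assoc, homComp_ι, reassoc_of% e₁, reassoc_of% e₂]
    rw [← MonoidalClosed.assoc, associator_inv_naturality_assoc]
  homEquiv {A B} :=
    { toFun h := homLift (MonoidalClosed.curry' h.hom)
        fun f => (curry'_comp_homLeft_eq_iff f h.hom).2 (h.comm f)
      invFun g := ⟨MonoidalClosed.uncurry' (g ≫ homι A B), fun f =>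
        (curry'_comp_homLeft_eq_iff f _).1 (by
          rw [MonoidalClosed.curry'_uncurry', Category.assoc, homι_condition, Category.assoc])⟩
      left_inv h := by ext; simp
      right_inv g := by rw [← cancel_mono (homι A B)]; simp }
  homEquiv_id A := by
    rw [← cancel_mono (homι A A)]
    simp [eId, EnrichedCategory.id]
  homEquiv_comp {A B C} g h := by
    rw [← cancel_mono (homι A C)]
    simp [eComp, EnrichedCategory.comp, MonoidalClosed.curry'_comp]

/-- The comparison map `Str(L)(A, B) ⟶ [X, B]` induced by a morphism `η : X ⟶ A` in `V`: apply the
forgetful `V`-functor and restrict along `η`. -/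
noncomputable def comparison {A : Str L} {X : V} (η : X ⟶ A.carrier) (B : Str L) :
    (A ⟶[V] B) ⟶ (ihom X).obj B.carrier :=
  homι A B ≫ (MonoidalClosed.pre η).app B.carrier

end Str

variable [IsLocallyPresentableAsClosed V κ]

/-- A free `L`-structure `FX` on an object `X` of `V`, that is, a value at `X` of the left
`V`-adjoint of the forgetful `V`-functor: a structure with a unit `X ⟶ FX` such that the induced
maps `Str(L)(FX, A) ⟶ [X, A] = A ^ X` are all isomorphisms in `V`. -/
structure FreeStr (L : Language V κ) (X : V) where
  /-- the free structure -/
  str : Str L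
  /-- the unit -/
  unit : X ⟶ str.carrier
  isIso_comparison (A : Str L) : IsIso (Str.comparison unit A)

variable {L : Language V κ}

/-- The isomorphism `Str(L)(FX, A) ≅ A ^ X`. -/
noncomputable def FreeStr.homIso {X : V} (F : FreeStr L X) (A : Str L) :
    (F.str ⟶[V] A) ≅ (ihom X).obj A.carrier :=
  haveI := F.isIso_comparison A
  asIso (Str.comparison F.unit A)

/-- An extended term `t : (X, Y)`: a morphism `FY ⟶ FX` of `L`-structures. -/
abbrev ExtendedTerm (F : ∀ X : V, FreeStr L X) (X Y : V) : Type v :=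
  (F Y).str ⟶ (F X).str

/-- The interpretation `t_A : A ^ X ⟶ A ^ Y` of an extended term `t : (X, Y)`: the composite
`A ^ X ≅ Str(L)(FX, A) ⟶ Str(L)(FY, A) ≅ A ^ Y`. -/
noncomputable def ExtendedTerm.interp {F : ∀ X : V, FreeStr L X} {X Y : V}
    (t : ExtendedTerm F X Y) (A : Str L) :
    (ihom X).obj A.carrier ⟶ (ihom Y).obj A.carrier :=
  ((F X).homIso A).inv ≫ eHomWhiskerRight V t A ≫ ((F Y).homIso A).hom

/-- An equation `s = t` between extended terms of the same arity `(X, Y)`. -/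
structure Equation (F : ∀ X : V, FreeStr L X) where
  /-- the input arity -/
  X : V
  /-- the output arity -/
  Y : V
  /-- the left-hand side -/
  s : ExtendedTerm F X Y
  /-- the right-hand side -/
  t : ExtendedTerm F X Y

/-- The structure `A` satisfies the equation `s = t`, that is, `s_A = t_A`. -/
def Str.Satisfies {F : ∀ X : V, FreeStr L X} (A : Str L) (e : Equation F) : Prop :=
  e.s.interp A = e.t.interp A

/-- The class `Mod(E)` of models of a collection of equations. -/
def Mod {F : ∀ X : V, FreeStr L X} (E : Set (Equation F)) : ObjectProperty (Str L) :=
  fun A => ∀ e ∈ E, A.Satisfies e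

/-- A morphism of `L`-structures of the form `h : FX ⟶ W`. -/
structure FreeArrow (F : ∀ X : V, FreeStr L X) where
  /-- the object of generators of the domain -/
  X : V
  /-- the codomain -/
  W : Str L
  /-- the morphism -/
  h : (F X).str ⟶ W

/-- An object `A` of a `V`-category is orthogonal with respect to `h : B ⟶ C` (in the enriched
sense) if `h` induces an isomorphism between the hom-objects `K(C, A)` and `K(B, A)` in `V`. -/
def IsEnrichedOrthogonal (V : Type u) [Category.{v} V] [MonoidalCategory V] {K : Type*}
    [Category K] [EnrichedOrdinaryCategory V K] {B C : K} (h : B ⟶ C) (A : K) : Prop :=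
  IsIso (eHomWhiskerRight V h A)

/-- The orthogonality class defined by a collection of morphisms of the form `FX ⟶ W`. -/
def OrthogonalityClass {F : ∀ X : V, FreeStr L X} (H : Set (FreeArrow F)) :
    ObjectProperty (Str L) :=
  fun A => ∀ a ∈ H, IsEnrichedOrthogonal V a.h A

end Structures

/-- The regular cardinals of the universe `v`; bounds on arities are taken in
`WithTop RegularCardinal`, where `⊤` is the bound `∞`. -/
abbrev RegularCardinal : Type (v + 1) := { μ : Cardinal.{v} // μ.IsRegular }

/-- The full subcategory `V_μ` of `V`: the `μ`-presentable objects if `μ` is a regular cardinal, and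
all objects if `μ = ∞`. -/
def arities (V : Type u) [Category.{v} V] : WithTop RegularCardinal.{v} → ObjectProperty V
  | none => fun _ => True
  | some μ =>
    haveI : Fact μ.1.IsRegular := ⟨μ.2⟩
    isCardinalPresentable V μ.1

section Collections

variable {V : Type u} [Category.{v} V] [MonoidalCategory V] [MonoidalClosed V]
  {κ : Cardinal.{v}} [Fact κ.IsRegular] [IsLocallyPresentableAsClosed V κ] {L : Language V κ}

/-- A `μ`-ary equational theory: a collection of equations between extended terms all of whose
arities lie in `V_μ`. -/
def IsAryTheory {F : ∀ X : V, FreeStr L X} (μ : WithTop RegularCardinal.{v})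
    (E : Set (Equation F)) : Prop :=
  ∀ e ∈ E, arities V μ e.X ∧ arities V μ e.Y

/-- A collection of regular epimorphisms `FX ⟶ W` with `X` in `V_μ`. -/
def IsAryRegularEpiCollection {F : ∀ X : V, FreeStr L X} (μ : WithTop RegularCardinal.{v})
    (H : Set (FreeArrow F)) : Prop :=
  ∀ a ∈ H, arities V μ a.X ∧ IsRegularEpi a.h

end Collections

end EnrichedUA

/-!
Write `A ^ Z` for the structure on `[Z, A]` whose operations act pointwise (`Str.pow`). Morphisms
`Z ⟶ Str(L)(B, A)` in `V` correspond to morphisms of structures `B ⟶ A ^ Z`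
(`Str.homPowEquiv`), so every enriched notion becomes an ordinary one, quantified over `Z`: a
structure `A` is orthogonal to `h : B ⟶ C` if and only if each morphism `B ⟶ A ^ Z` factors uniquely
through `h`, it satisfies `s = t` if and only if `s ≫ k = t ≫ k` for all `k : FX ⟶ A ^ Z`, and a
structure is free on `X` as soon as it is so in the ordinary sense.

If `h : FX ⟶ W` is the coequalizer of `a, b : K ⟶ FX`, then `A` is orthogonal to `h` if and only if
`a ≫ k = b ≫ k` for all `k : FX ⟶ A ^ Z`. Applied to the coequalizer of `s` and `t`, this turns
equations into regular epimorphisms (`exists_orthogonalityClass_eq_mod`). Conversely, `a ≫ k` and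
`b ≫ k` agree if and only if they agree after restriction along the morphisms `FG ⟶ K`, with `G` in
a small separating set of presentable objects; these restrictions are equations
(`exists_mod_eq_orthogonalityClass`). If the bound on arities is a cardinal, the admissible arities
are essentially small, so only a small set of equations matters (`exists_small_mod_eq`).

It remains to construct free structures and coequalizers of structures, for a `κ`-ary language `L`.
Structures are the algebras
of the endofunctor `G A = ∐ Y ⊗ A ^ X`, over the symbols `(X, Y)`, and `G` preserves colimits of
chains of length `κ` because powers by `κ`-presentable objects do (`isCardinalAccessible_ihom`).
A partial algebra consists of morphisms `A ⟶ A'` and `G A ⟶ A'`; it is an algebra if the first is an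
isomorphism. Replacing `A'` by the pushout of `A' ⟵ G A ⟶ G A'`, and `A` by `A'`, extends its
operations freely by one step, and after `κ` steps one arrives at an algebra, the reflection of the
partial algebra (`PartialAlgebra.exists_reflection`). A free structure is the reflection of
`X ⟶ X ⨿ G X ⟵ G X`, and a coequalizer of structures `B ⇉ C` is the reflection of the partial
algebra formed by `C` and the coequalizer in `V`.
-/

namespace EnrichedUA

/-! ### Transposition and the symmetry of iterated internal homs -/

section Transposition

variable {V : Type u} [Category.{v} V] [MonoidalCategory V] [SymmetricCategory V]
  [MonoidalClosed V]

/-- The bijection between morphisms `Z ⟶ [A, B]` and morphisms `A ⟶ [Z, B]`. -/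
def transpose (Z A B : V) : (Z ⟶ (ihom A).obj B) ≃ (A ⟶ (ihom Z).obj B) where
  toFun g := MonoidalClosed.curry ((β_ Z A).hom ≫ MonoidalClosed.uncurry g)
  invFun k := MonoidalClosed.curry ((β_ A Z).hom ≫ MonoidalClosed.uncurry k)
  left_inv g := by simp
  right_inv g := by simp

theorem uncurry_transpose {Z A B : V} (g : Z ⟶ (ihom A).obj B) :
    MonoidalClosed.uncurry (transpose Z A B g) = (β_ Z A).hom ≫ MonoidalClosed.uncurry g := by
  simp [transpose]

theorem transpose_comp_pre {Z A A' B : V} (g : Z ⟶ (ihom A).obj B) (h : A' ⟶ A) :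
    transpose Z A' B (g ≫ (MonoidalClosed.pre h).app B) = h ≫ transpose Z A B g := by
  apply MonoidalClosed.uncurry_injective
  rw [uncurry_transpose, MonoidalClosed.uncurry_pre_app, MonoidalClosed.uncurry_natural_left,
    uncurry_transpose, BraidedCategory.braiding_naturality_right_assoc]

/-- The exchange `[X, [Z, B]] ⟶ [Z, [X, B]]` of the arguments of an iterated internal hom. -/
def ihomSwap (X Z B : V) :
    (ihom X).obj ((ihom Z).obj B) ⟶ (ihom Z).obj ((ihom X).obj B) :=
  MonoidalClosed.curry (MonoidalClosed.curry ((α_ X Z _).inv ≫ (β_ X Z).hom ▷ _ ≫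
    (α_ Z X _).hom ≫ Z ◁ (ihom.ev X).app _ ≫ (ihom.ev Z).app B))

theorem uncurry_uncurry_comp_ihomSwap {T X Z B : V} (k : T ⟶ (ihom X).obj ((ihom Z).obj B)) :
    MonoidalClosed.uncurry (MonoidalClosed.uncurry (k ≫ ihomSwap X Z B)) =
      (α_ X Z T).inv ≫ (β_ X Z).hom ▷ T ≫ (α_ Z X T).hom ≫
        MonoidalClosed.uncurry (MonoidalClosed.uncurry k) := by
  rw [MonoidalClosed.uncurry_natural_left, MonoidalClosed.uncurry_natural_left, ihomSwap,
    MonoidalClosed.uncurry_curry, MonoidalClosed.uncurry_curry,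
    associator_inv_naturality_right_assoc, whisker_exchange_assoc, associator_naturality_right_assoc,
    MonoidalClosed.uncurry_eq, MonoidalClosed.uncurry_eq, MonoidalCategory.whiskerLeft_comp_assoc]

@[simp]
theorem ihomSwap_ihomSwap (X Z B : V) : ihomSwap X Z B ≫ ihomSwap Z X B = 𝟙 _ := by
  apply MonoidalClosed.uncurry_injective
  apply MonoidalClosed.uncurry_injective
  have := uncurry_uncurry_comp_ihomSwap (𝟙 ((ihom X).obj ((ihom Z).obj B)))
  rw [Category.id_comp] at this
  rw [uncurry_uncurry_comp_ihomSwap, this]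
  simp [← comp_whiskerRight_assoc]

/-- Transposing the action of `(-) ^ X` on hom-objects. -/
theorem uncurry_ihom_map_transpose_comp_ihomSwap (X : V) {Z A B : V} (g : Z ⟶ (ihom A).obj B) :
    MonoidalClosed.uncurry ((ihom X).map (transpose Z A B g) ≫ ihomSwap X Z B) =
      (β_ Z _).hom ≫ _ ◁ g ≫ MonoidalClosed.comp X A B := by
  apply MonoidalClosed.uncurry_injective
  have e : MonoidalClosed.uncurry (transpose Z A B g) =
      (β_ Z A).hom ≫ A ◁ g ≫ (ihom.ev A).app B := by
    rw [uncurry_transpose, MonoidalClosed.uncurry_eq]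
  rw [uncurry_uncurry_comp_ihomSwap, MonoidalClosed.uncurry_ihom_map,
    MonoidalClosed.uncurry_natural_left]
  dsimp
  rw [e, BraidedCategory.braiding_naturality_right_assoc, MonoidalClosed.comp_eq,
    ← MonoidalClosed.curry_natural_left, ← MonoidalClosed.curry_natural_left,
    MonoidalClosed.uncurry_curry, MonoidalClosed.compTranspose_eq,
    associator_inv_naturality_right_assoc, whisker_exchange_assoc,
    BraidedCategory.braiding_tensor_right_hom]
  simp [← comp_whiskerRight_assoc]

end Transposition

/-! ### Cotensors of structures -/

namespace Str

section Forgetful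

variable {V : Type u} [Category.{v} V] [MonoidalCategory V] [MonoidalClosed V]
  {κ : Cardinal.{v}} [Fact κ.IsRegular] {L : Language V κ} [IsLocallyPresentableAsClosed V κ]

/-- The forgetful `V`-functor carries the restriction along a morphism of structures to the
restriction along its underlying morphism. -/
theorem eHomWhiskerRight_homι {A A' : Str L} (h : A' ⟶ A) (B : Str L) :
    eHomWhiskerRight V h B ≫ homι A' B = homι A B ≫ (MonoidalClosed.pre h.hom).app _ := by
  have e : eHomEquiv V h ≫ homι A' A = MonoidalClosed.curry' h.hom :=
    homLift_ι _ fun f => (curry'_comp_homLeft_eq_iff f h.hom).2 (h.comm f)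
  have : eHomWhiskerRight V h B ≫ homι A' B = (λ_ (homObj A B)).inv ≫ eHomEquiv V h ▷ homObj A B ≫
      homComp A' A B ≫ homι A' B := by
    simp only [eHomWhiskerRight, Category.assoc]; rfl
  rw [this, homComp_ι, MonoidalCategory.tensorHom_def_assoc, ← comp_whiskerRight_assoc]
  erw [e]
  rw [← whisker_exchange_assoc, MonoidalClosed.curry'_whiskerRight_comp,
    ← leftUnitor_inv_naturality_assoc, Iso.inv_hom_id_assoc]

end Forgetful

variable {V : Type u} [Category.{v} V] [MonoidalCategory V] [SymmetricCategory V]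
  [MonoidalClosed V] {κ : Cardinal.{v}} [Fact κ.IsRegular] {L : Language V κ}

/-- The cotensor `A ^ Z` of a structure `A` by an object `Z` of `V`: its underlying object is
`[Z, A]`, and the function symbols act pointwise. -/
abbrev pow (Z : V) (A : Str L) : Str L where
  carrier := (ihom Z).obj A.carrier
  interp f := ihomSwap (L.dom f) Z A.carrier ≫ (ihom Z).map (A.interp f) ≫
    ihomSwap Z (L.cod f) A.carrier

/-- A morphism `g : Z ⟶ [A, B]` equalizes the maps that define `Str(L)(A, B)` if and only if its
transpose `A ⟶ B ^ Z` is a morphism of structures. -/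
theorem comp_homLeft_eq_iff_transpose {A B : Str L} (f : L.Symb) {Z : V}
    (g : Z ⟶ (ihom A.carrier).obj B.carrier) :
    g ≫ homLeft A B f = g ≫ homRight A B f ↔
      A.interp f ≫ (ihom (L.cod f)).map (transpose Z _ _ g) =
        (ihom (L.dom f)).map (transpose Z _ _ g) ≫ (pow Z B).interp f := by
  rw [comp_homLeft_eq_iff]
  have : IsIso (ihomSwap (L.cod f) Z B.carrier) :=
    ⟨_, ihomSwap_ihomSwap _ _ _, ihomSwap_ihomSwap _ _ _⟩
  rw [← cancel_mono (ihomSwap (L.cod f) Z B.carrier),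
    ← cancel_epi (β_ Z _).hom]
  have h₁ : MonoidalClosed.uncurry ((A.interp f ≫ (ihom (L.cod f)).map (transpose Z _ _ g)) ≫
      ihomSwap (L.cod f) Z B.carrier) = (β_ Z _).hom ≫ A.interp f ▷ Z ≫ _ ◁ g ≫
        MonoidalClosed.comp (L.cod f) A.carrier B.carrier := by
    rw [Category.assoc, MonoidalClosed.uncurry_natural_left,
      uncurry_ihom_map_transpose_comp_ihomSwap, BraidedCategory.braiding_naturality_right_assoc]
  have h₂ : MonoidalClosed.uncurry (((ihom (L.dom f)).map (transpose Z _ _ g) ≫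
      (pow Z B).interp f) ≫ ihomSwap (L.cod f) Z B.carrier) =
        (β_ Z _).hom ≫ _ ◁ g ≫ MonoidalClosed.comp (L.dom f) A.carrier B.carrier ≫ B.interp f := by
    simp only [pow, Category.assoc, ihomSwap_ihomSwap, Category.comp_id]
    rw [← Category.assoc, MonoidalClosed.uncurry_natural_right,
      uncurry_ihom_map_transpose_comp_ihomSwap]
    simp only [Category.assoc]
  rw [← h₁, ← h₂, MonoidalClosed.uncurry_injective.eq_iff]

variable [IsLocallyPresentableAsClosed V κ]

/-- The universal property of the cotensor: morphisms `Z ⟶ Str(L)(A, B)` in `V` correspond to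
morphisms of structures `A ⟶ B ^ Z`. -/
noncomputable def homPowEquiv (Z : V) (A B : Str L) :
    (Z ⟶ (A ⟶[V] B)) ≃ (A ⟶ pow Z B) where
  toFun g := ⟨transpose Z _ _ (g ≫ homι A B), fun f =>
    (comp_homLeft_eq_iff_transpose f _).1 (by
      rw [Category.assoc, homι_condition, Category.assoc])⟩
  invFun k := homLift ((transpose Z _ _).symm k.hom) fun f =>
    (comp_homLeft_eq_iff_transpose f _).2 (by simpa using k.comm f)
  left_inv g := by rw [← cancel_mono (homι A B)]; simp
  right_inv k := by ext; simp

theorem homPowEquiv_hom {Z : V} {A B : Str L} (g : Z ⟶ (A ⟶[V] B)) :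
    (homPowEquiv Z A B g).hom = transpose Z _ _ (g ≫ homι A B) := rfl

theorem homPowEquiv_comp_eHomWhiskerRight {Z : V} {A A' B : Str L} (g : Z ⟶ (A ⟶[V] B))
    (h : A' ⟶ A) :
    homPowEquiv Z A' B (g ≫ eHomWhiskerRight V h B) = h ≫ homPowEquiv Z A B g := by
  ext
  rw [homPowEquiv_hom, Category.assoc, eHomWhiskerRight_homι, ← Category.assoc,
    transpose_comp_pre]
  rfl

theorem transpose_comp_comparison {X Z : V} {A B : Str L} (η : X ⟶ A.carrier)
    (g : Z ⟶ (A ⟶[V] B)) :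
    transpose Z _ _ (g ≫ comparison η B) = η ≫ (homPowEquiv Z A B g).hom := by
  rw [comparison, ← Category.assoc, transpose_comp_pre]
  rfl

/-- Enriched orthogonality is ordinary orthogonality of all cotensors. -/
theorem isEnrichedOrthogonal_iff {B C : Str L} (h : B ⟶ C) (A : Str L) :
    IsEnrichedOrthogonal V h A ↔
      ∀ Z : V, Function.Bijective fun k : C ⟶ pow Z A => h ≫ k := by
  rw [IsEnrichedOrthogonal, isIso_iff_yoneda_map_bijective]
  refine forall_congr' fun Z => ?_
  have : (fun k : C ⟶ pow Z A => h ≫ k) = homPowEquiv Z B A ∘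
      (fun x => x ≫ eHomWhiskerRight V h A) ∘ (homPowEquiv Z C A).symm := by
    ext1 k
    simp [homPowEquiv_comp_eHomWhiskerRight]
  rw [this, Equiv.comp_bijective, Equiv.bijective_comp]

/-- The comparison maps are isomorphisms if and only if the unit has the ordinary universal
property against all cotensors. -/
theorem isIso_comparison_iff {X : V} {A : Str L} (η : X ⟶ A.carrier) (B : Str L) :
    IsIso (comparison η B) ↔
      ∀ Z : V, Function.Bijective fun k : A ⟶ pow Z B => η ≫ k.hom := by
  rw [isIso_iff_yoneda_map_bijective]
  refine forall_congr' fun Z => ?_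
  have : (fun k : A ⟶ pow Z B => η ≫ k.hom) = transpose Z X B.carrier ∘
      (fun x => x ≫ comparison η B) ∘ (homPowEquiv Z A B).symm := by
    ext1 k
    simp [transpose_comp_comparison]
  rw [this, Equiv.comp_bijective, Equiv.bijective_comp]

/-- An equation holds in `A` if and only if its two sides are equalized, as morphisms of
structures, by every morphism into a cotensor of `A`. -/
theorem satisfies_iff {F : ∀ X : V, FreeStr L X} (A : Str L) (e : Equation F) :
    A.Satisfies e ↔ ∀ (Z : V) (k : (F e.X).str ⟶ pow Z A), e.s ≫ k = e.t ≫ k := by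
  have h : A.Satisfies e ↔ eHomWhiskerRight V e.s A = eHomWhiskerRight V e.t A := by
    simp [Satisfies, ExtendedTerm.interp]
  rw [h]
  constructor
  · intro h Z k
    obtain ⟨g, rfl⟩ := (homPowEquiv Z _ A).surjective k
    rw [← homPowEquiv_comp_eHomWhiskerRight, ← homPowEquiv_comp_eHomWhiskerRight, h]
  · intro h
    have := h _ (homPowEquiv _ _ A (𝟙 _))
    rw [← homPowEquiv_comp_eHomWhiskerRight, ← homPowEquiv_comp_eHomWhiskerRight] at this
    simpa using this

end Str

/-! ### Partial algebras for an endofunctor and their reflection into algebras -/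

/-- A partial algebra for an endofunctor `G`: an object `base` on which `G` acts with values in a
further object `val` under `base`. The algebras of `G` are the partial algebras for which
`incl : base ⟶ val` is an isomorphism. -/
structure PartialAlgebra {C : Type u} [Category.{v} C] (G : C ⥤ C) where
  /-- the object on which the operations are defined -/
  base : C
  /-- the object in which the operations take their values -/
  val : C
  /-- the comparison between the two -/
  incl : base ⟶ val
  /-- the operations -/
  act : G.obj base ⟶ val

namespace PartialAlgebra

variable {C : Type u} [Category.{v} C] {G : C ⥤ C}

/-- A morphism of partial algebras. -/
@[ext]
structure Hom (p q : PartialAlgebra G) where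
  /-- the morphism between the objects on which the operations are defined -/
  base : p.base ⟶ q.base
  /-- the morphism between the objects of values -/
  val : p.val ⟶ q.val
  incl_val : p.incl ≫ val = base ≫ q.incl
  act_val : p.act ≫ val = G.map base ≫ q.act

instance : Category (PartialAlgebra G) where
  Hom := Hom
  id p := ⟨𝟙 _, 𝟙 _, by simp, by simp⟩
  comp f g := ⟨f.base ≫ g.base, f.val ≫ g.val, by
    rw [reassoc_of% f.incl_val, g.incl_val, Category.assoc], by
    rw [reassoc_of% f.act_val, g.act_val, Functor.map_comp, Category.assoc]⟩

@[ext]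
theorem hom_ext {p q : PartialAlgebra G} {f g : p ⟶ q} (h₁ : Hom.base f = Hom.base g)
    (h₂ : Hom.val f = Hom.val g) : f = g :=
  Hom.ext h₁ h₂

@[simp]
theorem comp_base {p q r : PartialAlgebra G} (f : p ⟶ q) (g : q ⟶ r) :
    (f ≫ g).base = f.base ≫ g.base := rfl

@[simp]
theorem comp_val {p q r : PartialAlgebra G} (f : p ⟶ q) (g : q ⟶ r) :
    (f ≫ g).val = f.val ≫ g.val := rfl

variable (G) in
/-- The functor that sends a partial algebra to its object `base`. -/
@[simps]
def baseFunctor : PartialAlgebra G ⥤ C where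
  obj p := p.base
  map f := f.base

variable (G) in
/-- The functor that sends a partial algebra to its object `val`. -/
@[simps]
def valFunctor : PartialAlgebra G ⥤ C where
  obj p := p.val
  map f := f.val

variable (G) in
/-- The morphisms `incl`, as a natural transformation. -/
@[simps]
def inclTrans : baseFunctor G ⟶ valFunctor G where
  app p := p.incl
  naturality _ _ f := f.incl_val.symm

variable (G) in
/-- The morphisms `act`, as a natural transformation. -/
@[simps]
def actTrans : baseFunctor G ⋙ G ⟶ valFunctor G where
  app p := p.act
  naturality _ _ f := f.act_val.symm

section Colimits

universe w' w

variable {J : Type w} [Category.{w'} J] (F : J ⥤ PartialAlgebra G) [HasColimitsOfShape J C]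

/-- The comparison `colim G A_j ⟶ G (colim A_j)` for a diagram of partial algebras on `A_j`. -/
noncomputable def colimPost :
    colimit ((F ⋙ baseFunctor G) ⋙ G) ⟶ G.obj (colimit (F ⋙ baseFunctor G)) :=
  colimit.post (F ⋙ baseFunctor G) G

/-- The operations of a diagram of partial algebras, in the colimit. -/
noncomputable def colimAct :
    colimit ((F ⋙ baseFunctor G) ⋙ G) ⟶ colimit (F ⋙ valFunctor G) :=
  colimMap (Functor.whiskerLeft F (actTrans G) : (F ⋙ baseFunctor G) ⋙ G ⟶ F ⋙ valFunctor G)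

/-- The comparison between the two objects of a diagram of partial algebras, in the colimit. -/
noncomputable def colimIncl : colimit (F ⋙ baseFunctor G) ⟶ colimit (F ⋙ valFunctor G) :=
  colimMap (Functor.whiskerLeft F (inclTrans G))

/-- The coprojection into the colimit of the objects `base`. -/
noncomputable def ιBase (j : J) : (F.obj j).base ⟶ colimit (F ⋙ baseFunctor G) :=
  colimit.ι (F ⋙ baseFunctor G) j

/-- The coprojection into the colimit of the objects `val`. -/
noncomputable def ιVal (j : J) : (F.obj j).val ⟶ colimit (F ⋙ valFunctor G) :=
  colimit.ι (F ⋙ valFunctor G) j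

/-- The coprojection into the colimit of the objects on which the operations take their inputs. -/
noncomputable def ιArg (j : J) : G.obj (F.obj j).base ⟶ colimit ((F ⋙ baseFunctor G) ⋙ G) :=
  colimit.ι ((F ⋙ baseFunctor G) ⋙ G) j

/-- The morphism out of the colimit of the objects `base` that is induced by a cocone. -/
noncomputable def descBase (s : Cocone F) : colimit (F ⋙ baseFunctor G) ⟶ s.pt.base :=
  colimit.desc (F ⋙ baseFunctor G) ((baseFunctor G).mapCocone s)

/-- The morphism out of the colimit of the objects `val` that is induced by a cocone. -/
noncomputable def descVal (s : Cocone F) : colimit (F ⋙ valFunctor G) ⟶ s.pt.val :=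
  colimit.desc (F ⋙ valFunctor G) ((valFunctor G).mapCocone s)

theorem ιBase_descBase (s : Cocone F) (j : J) : ιBase F j ≫ descBase F s = (s.ι.app j).base :=
  colimit.ι_desc _ _

theorem ιVal_descVal (s : Cocone F) (j : J) : ιVal F j ≫ descVal F s = (s.ι.app j).val :=
  colimit.ι_desc _ _

theorem ιArg_colimPost (j : J) : ιArg F j ≫ colimPost F = G.map (ιBase F j) :=
  colimit.ι_post _ _ _

theorem ιArg_colimAct (j : J) : ιArg F j ≫ colimAct F = (F.obj j).act ≫ ιVal F j :=
  ι_colimMap _ _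

theorem ιBase_colimIncl (j : J) : ιBase F j ≫ colimIncl F = (F.obj j).incl ≫ ιVal F j :=
  ι_colimMap _ _

variable [HasPushouts C]

/-- The colimit of a diagram of partial algebras. As `G` need not preserve the colimit of the
objects `base`, its object `val` is a pushout that extends the operations from `colim G A_j`
to `G (colim A_j)`. -/
noncomputable abbrev colim : PartialAlgebra G where
  base := colimit (F ⋙ baseFunctor G)
  val := pushout (colimPost F) (colimAct F)
  incl := colimIncl F ≫ pushout.inr _ _
  act := pushout.inl _ _

/-- The colimit cocone of a diagram of partial algebras. -/
noncomputable abbrev colimCocone : Cocone F where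
  pt := colim F
  ι :=
    { app j :=
        { base := ιBase F j
          val := ιVal F j ≫ pushout.inr _ _
          incl_val := ((reassoc_of% ιBase_colimIncl F j) _).symm
          act_val := by
            have h := ιArg F j ≫= pushout.condition (f := colimPost F) (g := colimAct F)
            rw [reassoc_of% ιArg_colimPost F j, reassoc_of% ιArg_colimAct F j] at h
            exact h.symm }
      naturality i j f := by
        ext
        · exact (colimit.w (F ⋙ baseFunctor G) f).trans (Category.comp_id _).symm
        · exact (colimit.w_assoc (F ⋙ valFunctor G) f (pushout.inr _ _)).trans
            (Category.comp_id _).symm }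

/-- The morphism out of the colimit of partial algebras that is induced by a cocone. -/
noncomputable abbrev colimDesc (s : Cocone F) : colim F ⟶ s.pt where
  base := descBase F s
  val := pushout.desc (G.map (descBase F s) ≫ s.pt.act) (descVal F s)
    (colimit.hom_ext fun j => by
      refine ((reassoc_of% ιArg_colimPost F j) _).trans
        (Eq.trans ?_ ((reassoc_of% ιArg_colimAct F j) _).symm)
      rw [ιVal_descVal, ← Functor.map_comp_assoc, ιBase_descBase]
      exact (s.ι.app j).act_val.symm)
  incl_val := colimit.hom_ext fun j => by
    rw [Category.assoc, pushout.inr_desc]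
    refine ((reassoc_of% ιBase_colimIncl F j) _).trans
      (Eq.trans ?_ ((reassoc_of% ιBase_descBase F s j) _).symm)
    rw [ιVal_descVal]
    exact (s.ι.app j).incl_val
  act_val := pushout.inl_desc _ _ _

/-- The cocone of partial algebras is a colimit. -/
noncomputable def isColimitColimCocone : IsColimit (colimCocone F) where
  desc s := colimDesc F s
  fac s j := by
    refine PartialAlgebra.hom_ext (ιBase_descBase F s j) ?_
    refine (Category.assoc _ _ _).trans ((_ ≫= pushout.inr_desc _ _ _).trans ?_)
    exact ιVal_descVal F s j
  uniq s m hm := by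
    have hb : m.base = descBase F s :=
      colimit.hom_ext fun j => (congr_arg Hom.base (hm j)).trans (ιBase_descBase F s j).symm
    refine PartialAlgebra.hom_ext hb (pushout.hom_ext ?_ ?_)
    · refine Eq.trans ?_ (pushout.inl_desc _ _ _).symm
      rw [← hb]
      exact m.act_val
    · refine Eq.trans ?_ (pushout.inr_desc _ _ _).symm
      exact colimit.hom_ext fun j => (Category.assoc _ _ _).symm.trans
        ((congr_arg Hom.val (hm j)).trans (ιVal_descVal F s j).symm)

instance : HasColimitsOfShape J (PartialAlgebra G) where
  has_colimit F := ⟨_, isColimitColimCocone F⟩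

instance : PreservesColimitsOfShape J (baseFunctor G) where
  preservesColimit {F} := preservesColimit_of_preserves_colimit_cocone (isColimitColimCocone F)
    ((colimit.isColimit (F ⋙ baseFunctor G)).ofIsoColimit
      (Cocone.ext (Iso.refl _) fun _ => Category.comp_id _))

/-- Colimits of partial algebras that `G` preserves are computed in each component. -/
instance [PreservesColimitsOfShape J G] : PreservesColimitsOfShape J (valFunctor G) where
  preservesColimit {F} := by
    have : IsIso (colimPost F) :=
      inferInstanceAs (IsIso (colimit.post (F ⋙ baseFunctor G) G))
    let e : colimit (F ⋙ valFunctor G) ≅ pushout (colimPost F) (colimAct F) :=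
      asIso (pushout.inr _ _)
    exact preservesColimit_of_preserves_colimit_cocone (isColimitColimCocone F)
      ((colimit.isColimit (F ⋙ valFunctor G)).ofIsoColimit
        (Cocone.ext e fun _ => rfl))

end Colimits

section Reflection

variable [HasPushouts C]

/-- One step of the free extension of a partial algebra to an algebra: the operations are extended
freely from `base` to `val`. -/
noncomputable abbrev succ (p : PartialAlgebra G) : PartialAlgebra G where
  base := p.val
  val := pushout p.act (G.map p.incl)
  incl := pushout.inl _ _
  act := pushout.inr _ _

/-- The inclusion of a partial algebra into its free one-step extension. -/
noncomputable abbrev toSucc (p : PartialAlgebra G) : p ⟶ p.succ where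
  base := p.incl
  val := pushout.inl _ _
  incl_val := rfl
  act_val := pushout.condition

variable (G) in
/-- The property of a partial algebra to be an algebra. -/
def isTotal : ObjectProperty (PartialAlgebra G) := fun p => IsIso p.incl

/-- A morphism from a partial algebra to an algebra extends uniquely to the next step. -/
theorem isLocal_toSucc (p : PartialAlgebra G) : (isTotal G).isLocal p.toSucc := by
  intro q (hq : IsIso q.incl)
  constructor
  · intro m n hmn
    have he : pushout.inl p.act (G.map p.incl) ≫ m.val =
        pushout.inl p.act (G.map p.incl) ≫ n.val := congr_arg Hom.val hmn
    have hb : m.base = n.base := by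
      rw [← cancel_mono q.incl, ← m.incl_val, ← n.incl_val]
      exact he
    refine PartialAlgebra.hom_ext hb (pushout.hom_ext he ?_)
    exact m.act_val.trans ((congr_arg (fun k => G.map k ≫ q.act) hb).trans n.act_val.symm)
  · intro k
    have hk : p.incl ≫ k.val ≫ inv q.incl = k.base := by
      rw [reassoc_of% k.incl_val, IsIso.hom_inv_id, Category.comp_id]
    refine ⟨{ base := k.val ≫ inv q.incl
              val := pushout.desc k.val (G.map (k.val ≫ inv q.incl) ≫ q.act) ?_
              incl_val := by
                rw [pushout.inl_desc, Category.assoc, IsIso.inv_hom_id, Category.comp_id]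
              act_val := pushout.inr_desc _ _ _ }, ?_⟩
    · rw [← Functor.map_comp_assoc, hk, k.act_val]
    · ext
      · exact hk
      · exact pushout.inl_desc _ _ _

/-- The successor structure whose transfinite iteration is the free extension of a partial algebra
to an algebra. -/
@[simps]
noncomputable def succStruct (p : PartialAlgebra G) :
    SmallObject.SuccStruct (PartialAlgebra G) where
  X₀ := p
  succ := succ
  toSucc := toSucc

/-- If `G` preserves colimits of chains of length `κ`, then every partial algebra has a reflection
into algebras, namely the `κ`-th iterate of the free one-step extension. -/
theorem exists_reflection (κ : Cardinal.{v}) [Fact κ.IsRegular] [HasColimitsOfSize.{v, v} C]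
    [PreservesColimitsOfShape κ.ord.ToType G] (p : PartialAlgebra G) :
    ∃ (r : PartialAlgebra G) (η : p ⟶ r), IsIso r.incl ∧ (isTotal G).isLocal η := by
  have : Nonempty κ.ord.ToType := by simpa using Cardinal.IsRegular.ne_zero Fact.out
  have := WellFoundedLT.toOrderBot κ.ord.ToType
  have := Cardinal.noMaxOrder (Fact.elim inferInstance : κ.IsRegular).aleph0_le
  have : HasIterationOfShape κ.ord.ToType (PartialAlgebra G) := { }
  let H := p.succStruct.transfiniteCompositionOfShapeιIteration κ.ord.ToType
  refine ⟨_, p.succStruct.ιIteration κ.ord.ToType, ?_, ?_⟩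
  · -- The value object at stage `j` is the base object at stage `j + 1`.
    let w (j : κ.ord.ToType) : (H.F.obj j).val ⟶ (H.F.obj (Order.succ j)).base :=
      (p.succStruct.iterationFunctorObjSuccIso j (not_isMax j)).inv.base
    have hmap (j : κ.ord.ToType) : H.F.map (homOfLE (Order.le_succ j)) =
        toSucc _ ≫ (p.succStruct.iterationFunctorObjSuccIso j (not_isMax j)).inv :=
      p.succStruct.iterationFunctor_map_succ j (not_isMax j)
    have hbase (j : κ.ord.ToType) : (H.F.map (homOfLE (Order.le_succ j))).base =
        (H.F.obj j).incl ≫ w j := congr_arg Hom.base (hmap j)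
    have hval (j : κ.ord.ToType) : (H.F.map (homOfLE (Order.le_succ j))).val =
        w j ≫ (H.F.obj (Order.succ j)).incl :=
      (congr_arg Hom.val (hmap j)).trans
        (p.succStruct.iterationFunctorObjSuccIso j (not_isMax j)).inv.incl_val
    -- Hence the two objects of the colimit agree; the legs of `c` define an inverse of `incl`.
    have hB := isColimitOfPreserves (baseFunctor G) H.isColimit
    have hE := isColimitOfPreserves (valFunctor G) H.isColimit
    let c : Cocone (H.F ⋙ valFunctor G) :=
      { pt := (p.succStruct.iteration κ.ord.ToType).base
        ι :=
          { app j := w j ≫ (H.incl.app (Order.succ j)).base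
            naturality j k f := by
              obtain h | h := (leOfHom f).eq_or_lt
              · subst h
                obtain rfl : f = 𝟙 _ := Subsingleton.elim _ _
                refine ((H.F ⋙ valFunctor G).map_id j =≫ _).trans ?_
                exact (Category.id_comp _).trans (Category.comp_id _).symm
              · have e : f = homOfLE (Order.le_succ j) ≫ homOfLE (Order.succ_le_of_lt h) :=
                  Subsingleton.elim _ _
                have e' : H.F.map (homOfLE (Order.succ_le_of_lt h)) ≫
                    H.F.map (homOfLE (Order.le_succ k)) ≫ H.incl.app (Order.succ k) =
                      H.incl.app (Order.succ j) := by
                  simp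
                have e'' : (H.F.map f).val ≫ w k ≫ (H.incl.app (Order.succ k)).base =
                    w j ≫ (H.incl.app (Order.succ j)).base := by
                  rw [e, Functor.map_comp, comp_val, hval, Category.assoc,
                    Category.assoc,
                    reassoc_of% (H.F.map (homOfLE (Order.succ_le_of_lt h))).incl_val, ← e',
                    comp_base, comp_base, hbase, Category.assoc]
                exact e''.trans (Category.comp_id _).symm } }
    have hι (j : κ.ord.ToType) := H.incl.naturality (homOfLE (Order.le_succ j))
    refine ⟨hE.desc c, hB.hom_ext fun j => ?_, hE.hom_ext fun j => ?_⟩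
    · have h₁ : (H.incl.app j).val ≫ hE.desc c = w j ≫ (H.incl.app (Order.succ j)).base :=
        hE.fac c j
      have h₂ := congr_arg Hom.base (hι j)
      rw [comp_base, comp_base, hbase, Category.assoc] at h₂
      refine ((reassoc_of% (H.incl.app j).incl_val) _).symm.trans ?_
      rw [h₁]
      exact h₂
    · have h₁ : (H.incl.app j).val ≫ hE.desc c = w j ≫ (H.incl.app (Order.succ j)).base :=
        hE.fac c j
      have h₂ := congr_arg Hom.val (hι j)
      rw [comp_val, comp_val, hval, Category.assoc, Hom.incl_val] at h₂
      refine (Category.assoc _ _ _).symm.trans ?_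
      refine (h₁ =≫ _).trans ((Category.assoc _ _ _).trans ?_)
      exact h₂
  · exact (isTotal G).isLocal.transfiniteCompositionsOfShape_le κ.ord.ToType _
      ⟨H.ofLE (by rintro q _ _ ⟨_⟩; exact isLocal_toSucc q)⟩

end Reflection

end PartialAlgebra

/-! ### Accessibility of the internal hom -/

section Accessible

variable {V : Type u} [Category.{v} V] [MonoidalCategory V] [MonoidalClosed V]
  (κ : Cardinal.{v}) [Fact κ.IsRegular] [IsLocallyPresentableAsClosed V κ]

/-- A morphism in a locally `κ`-presentable category is an isomorphism if it is seen as one by all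
`κ`-presentable objects. -/
theorem jointlyReflectIsomorphisms_coyoneda (V : Type u) [Category.{v} V] (κ : Cardinal.{v})
    [Fact κ.IsRegular] [IsCardinalLocallyPresentable V κ] :
    JointlyReflectIsomorphisms fun g : (isCardinalPresentable V κ).FullSubcategory =>
      coyoneda.obj (Opposite.op g.obj) where
  isIso {X Y} f hf := by
    obtain ⟨P, _, hP, hP'⟩ :=
      (IsCardinalLocallyPresentable.iff_exists_isStrongGenerator V κ).1 inferInstance
    have hbij (g : V) (hg : P g) : Function.Bijective fun x : g ⟶ X => x ≫ f :=
      (isIso_iff_bijective _).1 (hf ⟨g, hP' g hg⟩)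
    have : Mono f := ⟨fun a b h => hP.isSeparating _ _ fun g hg x =>
      (hbij g hg).1 (by simpa using x ≫= h)⟩
    exact hP.isIso_of_mono f fun g hg => (hbij g hg).2

/-- Powers by `κ`-presentable objects preserve `κ`-filtered colimits. -/
theorem isCardinalAccessible_ihom (X : V) (hX : IsCardinalPresentable X κ) :
    (ihom X).IsCardinalAccessible κ where
  preservesColimitOfShape J _ _ := ⟨fun {D} => ⟨fun {c} hc => by
    have h (g : (isCardinalPresentable V κ).FullSubcategory) :
        PreservesColimitsOfShape J (coyoneda.obj (Opposite.op g.obj)) :=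
      have := g.property
      preservesColimitsOfShape_of_isCardinalPresentable g.obj κ J
    refine ⟨(jointlyReflectIsomorphisms_coyoneda V κ).jointlyReflectsColimit fun g => ?_⟩
    have : IsCardinalPresentable (X ⊗ g.obj) κ :=
      IsLocallyPresentableAsClosed.tensor_presentable _ _ hX g.property
    have := preservesColimitsOfShape_of_isCardinalPresentable (X ⊗ g.obj) κ J
    let e : coyoneda.obj (Opposite.op (X ⊗ g.obj)) ≅
        ihom X ⋙ coyoneda.obj (Opposite.op g.obj) :=
      NatIso.ofComponents (fun A => ((ihom.adjunction X).homEquiv g.obj A).toIso)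
        (fun f => by ext x; exact (ihom.adjunction X).homEquiv_naturality_right x f)
    have := preservesColimitsOfShape_of_natIso (J := J) e
    exact isColimitOfPreserves (ihom X ⋙ coyoneda.obj (Opposite.op g.obj)) hc⟩⟩

end Accessible

/-! ### Structures as algebras for an endofunctor -/

/-- A colimit of functors that preserve colimits of a given shape preserves them. -/
theorem preservesColimitsOfShape_colimit {C D J K : Type*} [Category* C] [Category* D]
    [Category* J] [Category* K] [HasColimitsOfShape K D] (F : K ⥤ C ⥤ D)
    [∀ k, PreservesColimitsOfShape J (F.obj k)] : PreservesColimitsOfShape J (colimit F) := by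
  have : PreservesColimitsOfShape J F.flip := ⟨fun {_} => ⟨fun hc =>
    ⟨evaluationJointlyReflectsColimits _ fun k => isColimitOfPreserves (F.obj k) hc⟩⟩⟩
  exact preservesColimitsOfShape_of_natIso (colimitIsoFlipCompColim F).symm

section Signature

variable {V : Type u} [Category.{v} V] [MonoidalCategory V] [MonoidalClosed V]
  {κ : Cardinal.{v}} [Fact κ.IsRegular] [HasColimitsOfSize.{v, v} V] (L : Language V κ)

/-- The endofunctor `A ↦ ∐ Y ⊗ A ^ X`, over the symbols `f : (X, Y)`, whose algebras are the
structures. -/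
noncomputable def Language.endofunctor : V ⥤ V :=
  ∐ fun f : L.Symb => ihom (L.dom f) ⋙ tensorLeft (L.cod f)

namespace Language

/-- The coprojection at a symbol `f`. -/
noncomputable def ι (f : L.Symb) (A : V) :
    L.cod f ⊗ (ihom (L.dom f)).obj A ⟶ L.endofunctor.obj A :=
  (Sigma.ι (fun f : L.Symb => ihom (L.dom f) ⋙ tensorLeft (L.cod f)) f).app A

theorem ι_naturality (f : L.Symb) {A B : V} (h : A ⟶ B) :
    L.ι f A ≫ L.endofunctor.map h = L.cod f ◁ (ihom (L.dom f)).map h ≫ L.ι f B :=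
  ((Sigma.ι (fun f : L.Symb => ihom (L.dom f) ⋙ tensorLeft (L.cod f)) f).naturality h).symm

/-- The coprojections exhibit the values of the endofunctor as coproducts. -/
noncomputable def isColimitCofan (A : V) :
    IsColimit (Cofan.mk (L.endofunctor.obj A) fun f => L.ι f A) := by
  exact isColimitCofanMkObjOfIsColimit ((evaluation V V).obj A) _ _ (coproductIsCoproduct
    fun f : L.Symb => ihom (L.dom f) ⋙ tensorLeft (L.cod f))

variable {L} in
theorem hom_ext {A B : V} {g h : L.endofunctor.obj A ⟶ B}
    (w : ∀ f, L.ι f A ≫ g = L.ι f A ≫ h) : g = h :=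
  Cofan.IsColimit.hom_ext (L.isColimitCofan A) _ _ w

/-- The morphism out of a value of the endofunctor that is induced by a family of operations
`A ^ X ⟶ B ^ Y`. -/
noncomputable def desc {A B : V}
    (k : ∀ f : L.Symb, (ihom (L.dom f)).obj A ⟶ (ihom (L.cod f)).obj B) :
    L.endofunctor.obj A ⟶ B :=
  Cofan.IsColimit.desc (L.isColimitCofan A) fun f => MonoidalClosed.uncurry (k f)

@[simp]
theorem ι_desc {A B : V} (k : ∀ f : L.Symb, (ihom (L.dom f)).obj A ⟶ (ihom (L.cod f)).obj B)
    (f : L.Symb) : L.ι f A ≫ L.desc k = MonoidalClosed.uncurry (k f) :=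
  Cofan.IsColimit.fac (L.isColimitCofan A) _ f

end Language

/-- A structure, as a partial algebra. -/
noncomputable abbrev Str.toPartialAlgebra {L : Language V κ} (A : Str L) :
    PartialAlgebra L.endofunctor where
  base := A.carrier
  val := A.carrier
  incl := 𝟙 _
  act := L.desc A.interp

/-- A morphism in `V` between structures is a morphism of algebras for the endofunctor of the language
if and only if it commutes with every operation. -/
theorem Str.act_comp_eq_iff {L : Language V κ} {A B : Str L} (h : A.carrier ⟶ B.carrier) :
    L.desc A.interp ≫ h = L.endofunctor.map h ≫ L.desc B.interp ↔
      ∀ f, A.interp f ≫ (ihom (L.cod f)).map h = (ihom (L.dom f)).map h ≫ B.interp f := by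
  have key (f : L.Symb) : L.ι f A.carrier ≫ L.desc A.interp ≫ h =
      L.ι f A.carrier ≫ L.endofunctor.map h ≫ L.desc B.interp ↔
      A.interp f ≫ (ihom (L.cod f)).map h = (ihom (L.dom f)).map h ≫ B.interp f := by
    rw [reassoc_of% L.ι_desc A.interp f, reassoc_of% L.ι_naturality f h, L.ι_desc,
      ← MonoidalClosed.uncurry_injective.eq_iff, MonoidalClosed.uncurry_natural_right,
      MonoidalClosed.uncurry_natural_left]
  exact ⟨fun w f => (key f).1 (by rw [w]), fun w => Language.hom_ext fun f => (key f).2 (w f)⟩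

variable {L} in
/-- The morphisms of structures are the morphisms of the corresponding partial algebras. -/
noncomputable def Str.homEquivPartialAlgebra {A B : Str L} :
    (A ⟶ B) ≃ (A.toPartialAlgebra ⟶ B.toPartialAlgebra) where
  toFun h :=
    { base := h.hom
      val := h.hom
      incl_val := (Category.id_comp _).trans (Category.comp_id _).symm
      act_val := (Str.act_comp_eq_iff h.hom).2 h.comm }
  invFun g := ⟨g.base, (Str.act_comp_eq_iff g.base).1 (by
    have e : g.val = g.base :=
      (Category.id_comp _).symm.trans (g.incl_val.trans (Category.comp_id _))
    exact (congr_arg _ e).symm.trans g.act_val)⟩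
  left_inv _ := rfl
  right_inv g := by
    have e : g.val = g.base :=
      (Category.id_comp _).symm.trans (g.incl_val.trans (Category.comp_id _))
    exact PartialAlgebra.hom_ext rfl e.symm

theorem Str.homEquivPartialAlgebra_comp {L : Language V κ} {A B C : Str L} (g : A ⟶ B)
    (h : B ⟶ C) : homEquivPartialAlgebra (g ≫ h) =
      homEquivPartialAlgebra g ≫ homEquivPartialAlgebra h := rfl

end Signature

section Existence

variable {V : Type u} [Category.{v} V] [MonoidalCategory V] [MonoidalClosed V]
  {κ : Cardinal.{v}} [Fact κ.IsRegular] [IsLocallyPresentableAsClosed V κ] (L : Language V κ)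

/-- As the arities are `κ`-presentable, the endofunctor of a `κ`-ary language preserves colimits of
chains of length `κ`. -/
theorem preservesColimitsOfShape_endofunctor :
    PreservesColimitsOfShape κ.ord.ToType L.endofunctor := by
  have (f : Discrete L.Symb) : PreservesColimitsOfShape κ.ord.ToType
      ((Discrete.functor fun f : L.Symb => ihom (L.dom f) ⋙ tensorLeft (L.cod f)).obj f) := by
    have := isCardinalAccessible_ihom κ _ (L.dom_presentable f.as)
    have := (ihom (L.dom f.as)).preservesColimitsOfShape_of_isCardinalAccessible κ κ.ord.ToType
    exact inferInstanceAs (PreservesColimitsOfShape κ.ord.ToType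
      (ihom (L.dom f.as) ⋙ tensorLeft (L.cod f.as)))
  exact preservesColimitsOfShape_colimit _

variable {L}

/-- Every partial algebra has a reflection into structures. -/
theorem exists_reflection_str (p : PartialAlgebra L.endofunctor) :
    ∃ (R : Str L) (η : p ⟶ R.toPartialAlgebra), ∀ A : Str L,
      Function.Bijective fun k : R ⟶ A => η ≫ Str.homEquivPartialAlgebra k := by
  have := preservesColimitsOfShape_endofunctor L
  obtain ⟨r, η, hr, hη⟩ := PartialAlgebra.exists_reflection κ p
  let R : Str L := ⟨r.base, fun f => MonoidalClosed.curry (L.ι f r.base ≫ r.act ≫ inv r.incl)⟩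
  have hR : L.desc R.interp = r.act ≫ inv r.incl := Language.hom_ext fun f => by
    rw [L.ι_desc, MonoidalClosed.uncurry_curry]
  let e : r ≅ R.toPartialAlgebra :=
    { hom :=
        { base := 𝟙 _
          val := inv r.incl
          incl_val := (IsIso.hom_inv_id _).trans (Category.comp_id _).symm
          act_val := hR.symm.trans
            ((congr_arg (· ≫ _) (L.endofunctor.map_id _)).trans (Category.id_comp _)).symm }
      inv :=
        { base := 𝟙 _
          val := r.incl
          incl_val := rfl
          act_val := by
            refine Eq.trans ?_ ((congr_arg (· ≫ _) (L.endofunctor.map_id _)).trans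
              (Category.id_comp _)).symm
            refine (congr_arg (· ≫ _) hR).trans ?_
            rw [Category.assoc, IsIso.inv_hom_id, Category.comp_id] }
      hom_inv_id := PartialAlgebra.hom_ext (Category.comp_id _) (IsIso.inv_hom_id _)
      inv_hom_id := PartialAlgebra.hom_ext (Category.comp_id _) (IsIso.hom_inv_id _) }
  refine ⟨R, η ≫ e.hom, fun A => ?_⟩
  have h₁ := hη A.toPartialAlgebra (inferInstanceAs (IsIso (𝟙 A.carrier)))
  have h₂ : Function.Bijective fun g : R.toPartialAlgebra ⟶ A.toPartialAlgebra => e.hom ≫ g :=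
    e.symm.homFromEquiv.bijective
  have h₃ : Function.Bijective fun k : R ⟶ A => Str.homEquivPartialAlgebra k :=
    Str.homEquivPartialAlgebra.bijective
  convert h₁.comp (h₂.comp h₃) using 1
  exact funext fun k => Category.assoc _ _ _

/-- The free structure on `X` is the reflection of the partial algebra on `X` whose operations are
adjoined freely. -/
theorem exists_free (X : V) : ∃ (R : Str L) (η : X ⟶ R.carrier), ∀ A : Str L,
    Function.Bijective fun k : R ⟶ A => η ≫ k.hom := by
  let p : PartialAlgebra L.endofunctor := ⟨X, X ⨿ L.endofunctor.obj X, coprod.inl, coprod.inr⟩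
  obtain ⟨R, η, h⟩ := exists_reflection_str p
  refine ⟨R, η.base, fun A => ?_⟩
  have hp : Function.Bijective fun g : p ⟶ A.toPartialAlgebra => g.base := by
    constructor
    · intro g g' (e : g.base = g'.base)
      refine PartialAlgebra.hom_ext e (coprod.hom_ext ?_ ?_)
      · exact g.incl_val.trans ((congr_arg (· ≫ _) e).trans g'.incl_val.symm)
      · exact g.act_val.trans ((congr_arg (fun k => L.endofunctor.map k ≫ _) e).trans
          g'.act_val.symm)
    · intro x
      exact ⟨⟨x, coprod.desc x (L.endofunctor.map x ≫ L.desc A.interp),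
        (coprod.inl_desc _ _).trans (Category.comp_id _).symm, coprod.inr_desc _ _⟩, rfl⟩
  exact hp.comp (h A)

instance : HasCoequalizers (Str L) := by
  have (B C : Str L) (s t : B ⟶ C) : HasCoequalizer s t := by
    -- The coequalizer is the reflection of the partial algebra that consists of `C` and of the
    -- coequalizer `π` in `V`.
    let π := coequalizer.π s.hom t.hom
    let p : PartialAlgebra L.endofunctor :=
      ⟨C.carrier, coequalizer s.hom t.hom, π, L.desc C.interp ≫ π⟩
    obtain ⟨R, η, hη⟩ := exists_reflection_str p
    let c : C.toPartialAlgebra ⟶ p :=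
      ⟨𝟙 _, π, (Category.id_comp _).trans (Category.id_comp _).symm,
        ((congr_arg (· ≫ _) (L.endofunctor.map_id _)).trans (Category.id_comp _)).symm⟩
    let h : C ⟶ R := Str.homEquivPartialAlgebra.symm (c ≫ η)
    have hh : Str.homEquivPartialAlgebra h = c ≫ η :=
      Equiv.apply_symm_apply _ _
    have hval : h.hom = π ≫ η.val := congr_arg PartialAlgebra.Hom.val hh
    have w : s ≫ h = t ≫ h := by
      ext
      rw [Str.comp_hom, Str.comp_hom, hval, ← Category.assoc, ← Category.assoc,
        coequalizer.condition]
    have hc (A : Str L) (g g' : p ⟶ A.toPartialAlgebra) (e : c ≫ g = c ≫ g') : g = g' :=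
      PartialAlgebra.hom_ext
        ((Category.id_comp _).symm.trans
          ((congr_arg PartialAlgebra.Hom.base e).trans (Category.id_comp _)))
        (coequalizer.hom_ext (congr_arg PartialAlgebra.Hom.val e))
    have key (A : Str L) (g : C ⟶ A) (hg : s ≫ g = t ≫ g) : ∃ k : R ⟶ A, h ≫ k = g := by
      have hg' : s.hom ≫ g.hom = t.hom ≫ g.hom := congr_arg Str.Hom.hom hg
      obtain ⟨k, hk⟩ := (hη A).2 ⟨g.hom, coequalizer.desc g.hom hg',
        (coequalizer.π_desc _ _).trans (Category.comp_id _).symm, by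
          refine (Category.assoc _ _ _).trans ((_ ≫= coequalizer.π_desc _ _).trans ?_)
          exact (Str.act_comp_eq_iff g.hom).2 g.comm⟩
      refine ⟨k, Str.homEquivPartialAlgebra.injective ?_⟩
      rw [Str.homEquivPartialAlgebra_comp, hh, Category.assoc]
      refine (c ≫= hk).trans (PartialAlgebra.hom_ext (Category.id_comp _)
        (coequalizer.π_desc _ _))
    choose k hk using key
    exact ⟨_, Cofork.IsColimit.mk (Cofork.ofπ h w) (fun q => k _ q.π q.condition)
      (fun q => hk _ _ _) fun q m hm => (hη _).1 (hc _ _ _ (by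
        dsimp only
        rw [← Category.assoc, ← Category.assoc, ← hh, ← Str.homEquivPartialAlgebra_comp,
          ← Str.homEquivPartialAlgebra_comp, hk]
        exact congr_arg _ hm))⟩
  exact hasCoequalizers_of_hasColimit_parallelPair _

end Existence

/-! ### Equations and orthogonality -/

section Arities

variable {V : Type u} [Category.{v} V] {κ : Cardinal.{v}} [Fact κ.IsRegular]

theorem arities_of_isCardinalPresentable {kap : WithTop RegularCardinal.{v}}
    (hkap : ((⟨κ, Fact.out⟩ : RegularCardinal.{v}) : WithTop RegularCardinal.{v}) ≤ kap) {X : V}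
    (hX : IsCardinalPresentable X κ) : arities V kap X := by
  cases kap with
  | top => trivial
  | coe μ =>
    have : Fact μ.1.IsRegular := ⟨μ.2⟩
    exact isCardinalPresentable_of_le X
      (show κ ≤ μ.1 from (WithTop.coe_le_coe (α := RegularCardinal)).1 hkap)

/-- If the bound `kap` is a cardinal, then the arities in `V_kap` form, up to isomorphism, a small
set. -/
theorem essentiallySmall_arities [IsCardinalLocallyPresentable V κ]
    {kap : WithTop RegularCardinal.{v}}
    (hkap : ((⟨κ, Fact.out⟩ : RegularCardinal.{v}) : WithTop RegularCardinal.{v}) ≤ kap)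
    (hkap' : kap ≠ ⊤) : ObjectProperty.EssentiallySmall.{v} (arities V kap) := by
  cases kap with
  | top => exact absurd rfl hkap'
  | coe μ =>
    have : Fact μ.1.IsRegular := ⟨μ.2⟩
    have := IsCardinalLocallyPresentable.of_le V
      (show κ ≤ μ.1 from (WithTop.coe_le_coe (α := RegularCardinal)).1 hkap)
    exact inferInstanceAs (ObjectProperty.EssentiallySmall.{v} (isCardinalPresentable V μ.1))

end Arities

section Unenriched

variable {V : Type u} [Category.{v} V] [MonoidalCategory V] [MonoidalClosed V]
  {κ : Cardinal.{v}} [Fact κ.IsRegular] [IsLocallyPresentableAsClosed V κ] {L : Language V κ}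

theorem curry'_comp_comparison {X : V} {A B : Str L} (η : X ⟶ A.carrier) (h : A ⟶ B) :
    eHomEquiv V h ≫ Str.comparison η B = MonoidalClosed.curry' (η ≫ h.hom) := by
  have e : eHomEquiv V h ≫ Str.homι A B = MonoidalClosed.curry' h.hom :=
    Str.homLift_ι _ fun f => (Str.curry'_comp_homLeft_eq_iff f h.hom).2 (h.comm f)
  rw [Str.comparison, reassoc_of% e, MonoidalClosed.curry', MonoidalClosed.curry',
    MonoidalClosed.curry_pre_app]
  simp

namespace FreeStr

/-- The ordinary universal property of a free structure. -/
theorem bijective_unit_comp {X : V} (F : FreeStr L X) (A : Str L) :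
    Function.Bijective fun k : F.str ⟶ A => F.unit ≫ k.hom := by
  have := F.isIso_comparison A
  have h₁ := (isIso_iff_yoneda_map_bijective _).1 this (𝟙_ V)
  have h₂ := MonoidalClosed.curryHomEquiv'.symm.bijective.comp
    (h₁.comp (eHomEquiv V (X := F.str) (Y := A)).bijective)
  convert h₂ using 1
  ext1 k
  simp [curry'_comp_comparison, MonoidalClosed.curryHomEquiv']

/-- The morphism of structures out of a free structure that extends a morphism in `V`. -/
noncomputable def lift {X : V} (F : FreeStr L X) {A : Str L} (x : X ⟶ A.carrier) : F.str ⟶ A :=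
  ((F.bijective_unit_comp A).2 x).choose

@[simp]
theorem unit_lift {X : V} (F : FreeStr L X) {A : Str L} (x : X ⟶ A.carrier) :
    F.unit ≫ (F.lift x).hom = x :=
  ((F.bijective_unit_comp A).2 x).choose_spec

theorem hom_ext {X : V} (F : FreeStr L X) {A : Str L} {g h : F.str ⟶ A}
    (w : F.unit ≫ g.hom = F.unit ≫ h.hom) : g = h :=
  (F.bijective_unit_comp A).1 w

/-- Free structures on isomorphic objects are isomorphic. -/
@[simps]
noncomputable def mapIso {X Y : V} (F : FreeStr L X) (F' : FreeStr L Y) (i : X ≅ Y) :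
    F.str ≅ F'.str where
  hom := F.lift (i.hom ≫ F'.unit)
  inv := F'.lift (i.inv ≫ F.unit)
  hom_inv_id := F.hom_ext (by simp [reassoc_of% F.unit_lift (i.hom ≫ F'.unit)])
  inv_hom_id := F'.hom_ext (by simp [reassoc_of% F'.unit_lift (i.inv ≫ F.unit)])

end FreeStr

/-- Two morphisms of structures agree if they agree on the free structures on a separating
collection of objects of `V`. -/
theorem Str.hom_ext_of_isSeparating (F : ∀ X : V, FreeStr L X) {S : ObjectProperty V}
    (hS : S.IsSeparating) {A B : Str L} {g h : A ⟶ B}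
    (w : ∀ (G : V) (_ : S G) (x : G ⟶ A.carrier), (F G).lift x ≫ g = (F G).lift x ≫ h) :
    g = h := by
  ext
  refine hS _ _ fun G hG x => ?_
  simpa [reassoc_of% (F G).unit_lift x] using (F G).unit ≫= congr_arg Str.Hom.hom (w G hG x)

end Unenriched

section Orthogonality

variable {V : Type u} [Category.{v} V] [MonoidalCategory V] [SymmetricCategory V]
  [MonoidalClosed V] {κ : Cardinal.{v}} [Fact κ.IsRegular] [IsLocallyPresentableAsClosed V κ]
  {L : Language V κ}

theorem nonempty_freeStr (L : Language V κ) (X : V) : Nonempty (FreeStr L X) := by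
  obtain ⟨R, η, h⟩ := exists_free (L := L) X
  exact ⟨R, η, fun A => (Str.isIso_comparison_iff η A).2 fun Z => h (Str.pow Z A)⟩

/-- A structure is orthogonal to the coequalizer of `a` and `b` if and only if every morphism into
one of its cotensors coequalizes `a` and `b`. -/
theorem isEnrichedOrthogonal_iff_of_isColimit {K B C : Str L} {a b : K ⟶ B} {h : B ⟶ C}
    {w : a ≫ h = b ≫ h} (hc : IsColimit (Cofork.ofπ h w)) (A : Str L) :
    IsEnrichedOrthogonal V h A ↔
      ∀ (Z : V) (k : B ⟶ Str.pow Z A), a ≫ k = b ≫ k := by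
  rw [Str.isEnrichedOrthogonal_iff]
  refine forall_congr' fun Z => ⟨fun H k => ?_, fun H => ⟨fun x y hxy => ?_, fun k => ?_⟩⟩
  · obtain ⟨m, rfl⟩ := H.2 k
    simp [reassoc_of% w]
  · exact Cofork.IsColimit.hom_ext hc hxy
  · exact ⟨_, (Cofork.IsColimit.desc' hc k (H k)).2⟩

variable {F : ∀ X : V, FreeStr L X}

/-- Conjugating both sides of an equation with isomorphisms of arities does not change its
models. -/
theorem satisfies_congr {X X' Y Y' : V} (i : X ≅ X') (j : Y ≅ Y') (s t : ExtendedTerm F X Y)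
    (A : Str L) :
    A.Satisfies (F := F) ⟨X', Y', ((F Y).mapIso (F Y') j).inv ≫ s ≫ ((F X).mapIso (F X') i).hom,
      ((F Y).mapIso (F Y') j).inv ≫ t ≫ ((F X).mapIso (F X') i).hom⟩ ↔
    A.Satisfies (F := F) ⟨X, Y, s, t⟩ := by
  rw [Str.satisfies_iff, Str.satisfies_iff]
  refine forall_congr' fun Z => ⟨fun h k => ?_, fun h k => ?_⟩
  · have := h (((F X).mapIso (F X') i).inv ≫ k)
    simpa only [Category.assoc, Iso.hom_inv_id_assoc, cancel_epi] using this
  · simpa only [Category.assoc, cancel_epi] using h (((F X).mapIso (F X') i).hom ≫ k)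

/-- The models of an equation `s = t` are the structures orthogonal to the coequalizer of `s` and
`t`. -/
theorem exists_orthogonalityClass_eq_mod {kap : WithTop RegularCardinal.{v}}
    {E : Set (Equation F)} (hE : IsAryTheory kap E) :
    ∃ H : Set (FreeArrow F), (Small.{v} E → Small.{v} H) ∧ IsAryRegularEpiCollection kap H ∧
      Mod E = OrthogonalityClass H := by
  refine ⟨(fun e => ⟨e.X, coequalizer e.s e.t, coequalizer.π e.s e.t⟩) '' E,
    fun _ => inferInstance, ?_, ?_⟩
  · rintro _ ⟨e, he, rfl⟩
    exact ⟨(hE e he).1, inferInstanceAs (IsRegularEpi (coequalizer.π e.s e.t))⟩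
  · ext A
    rw [OrthogonalityClass, Set.forall_mem_image]
    exact forall₂_congr fun e _ => (Str.satisfies_iff A e).trans
      (isEnrichedOrthogonal_iff_of_isColimit (coequalizerIsCoequalizer e.s e.t) A).symm

/-- If `h : FX ⟶ W` is the coequalizer of `a, b : K ⟶ FX`, then orthogonality to `h` is expressed by
the equations between the restrictions of `a` and `b` to the free structures over `K` on a small
separating set of `κ`-presentable objects. -/
theorem exists_mod_eq_orthogonalityClass {kap : WithTop RegularCardinal.{v}}
    (hkap : ((⟨κ, Fact.out⟩ : RegularCardinal.{v}) : WithTop RegularCardinal.{v}) ≤ kap)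
    {H : Set (FreeArrow F)} (hH : IsAryRegularEpiCollection kap H) :
    ∃ E : Set (Equation F), (Small.{v} H → Small.{v} E) ∧ IsAryTheory kap E ∧
      OrthogonalityClass H = Mod E := by
  obtain ⟨S, _, hS, hS'⟩ :=
    (IsCardinalLocallyPresentable.iff_exists_isStrongGenerator V κ).1 inferInstance
  let r (a : H) : RegularEpi a.1.h := (hH a.1 a.2).2.getStruct
  let ev (x : Σ (a : H) (G : Subtype S), G.1 ⟶ (r a).W.carrier) : Equation F :=
    ⟨x.1.1.X, x.2.1.1, (F x.2.1.1).lift x.2.2 ≫ (r x.1).left,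
      (F x.2.1.1).lift x.2.2 ≫ (r x.1).right⟩
  refine ⟨Set.range ev, fun _ => ?_, ?_, ?_⟩
  · have : Small.{v} (Subtype S) := inferInstanceAs (ObjectProperty.Small.{v} S)
    infer_instance
  · rintro _ ⟨x, rfl⟩
    exact ⟨(hH _ x.1.2).1, arities_of_isCardinalPresentable hkap (hS' _ x.2.1.2)⟩
  · ext A
    rw [Mod, Set.forall_mem_range]
    have key (a : H) : IsEnrichedOrthogonal V a.1.h A ↔ ∀ x, A.Satisfies (ev ⟨a, x⟩) := by
      rw [isEnrichedOrthogonal_iff_of_isColimit (r a).isColimit]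
      simp only [Str.satisfies_iff]
      refine ⟨fun h x Z k => ?_, fun h Z k => ?_⟩
      · exact (Category.assoc _ _ _).trans ((_ ≫= h Z k).trans (Category.assoc _ _ _).symm)
      · refine Str.hom_ext_of_isSeparating F hS.isSeparating fun G hG x => ?_
        exact (Category.assoc _ _ _).symm.trans ((h ⟨⟨G, hG⟩, x⟩ Z k).trans (Category.assoc _ _ _))
    exact ⟨fun h x => (key x.1).1 (h _ x.1.2) x.2, fun h a ha => (key ⟨a, ha⟩).2 fun x => h _⟩

/-- If the bound `kap` is a cardinal, then a `kap`-ary theory `E` has the same models as the set of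
all equations that hold in every model of `E` and whose arities belong to a fixed small set of
representatives of the objects of `V_kap`. -/
theorem exists_small_mod_eq {kap : WithTop RegularCardinal.{v}}
    (hkap : ((⟨κ, Fact.out⟩ : RegularCardinal.{v}) : WithTop RegularCardinal.{v}) ≤ kap)
    (hkap' : kap ≠ ⊤) {E : Set (Equation F)} (hE : IsAryTheory kap E) :
    ∃ E' : Set (Equation F), Small.{v} E' ∧ IsAryTheory kap E' ∧ Mod E = Mod E' := by
  have := essentiallySmall_arities (V := V) hkap hkap'
  obtain ⟨Q, _, hQ, hQ'⟩ := ObjectProperty.EssentiallySmall.exists_small_le.{v} (arities V kap)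
  have : Small.{v} (Subtype Q) := inferInstanceAs (ObjectProperty.Small.{v} Q)
  let ev (x : Σ (X Y : Subtype Q), ExtendedTerm F X.1 Y.1 × ExtendedTerm F X.1 Y.1) :
      Equation F := ⟨x.1.1, x.2.1.1, x.2.2.1, x.2.2.2⟩
  refine ⟨{e | e ∈ Set.range ev ∧ ∀ A, Mod E A → A.Satisfies e},
    small_subset fun _ h => h.1, ?_, ?_⟩
  · rintro _ ⟨⟨x, rfl⟩, -⟩
    exact ⟨hQ _ x.1.2, hQ _ x.2.1.2⟩
  · ext A
    refine ⟨fun hA e he => he.2 A hA, fun hA e he => ?_⟩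
    obtain ⟨X', hX', ⟨i⟩⟩ := hQ' _ (hE e he).1
    obtain ⟨Y', hY', ⟨j⟩⟩ := hQ' _ (hE e he).2
    exact (satisfies_congr i j e.s e.t A).1 (hA _ ⟨⟨⟨⟨X', hX'⟩, ⟨Y', hY'⟩, _, _⟩, rfl⟩,
      fun B hB => (satisfies_congr i j e.s e.t B).2 (hB e he)⟩)

end Orthogonality

end EnrichedUA

theorem mainTheorem9 {V : Type u} [Category.{v} V] [MonoidalCategory V] [SymmetricCategory V]
    [MonoidalClosed V] (lam : Cardinal.{v}) [hlam : Fact lam.IsRegular]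
    [EnrichedUA.IsLocallyPresentableAsClosed V lam] (L : EnrichedUA.Language V lam)
    (kap : WithTop EnrichedUA.RegularCardinal.{v})
    (hkap : ((⟨lam, hlam.out⟩ : EnrichedUA.RegularCardinal.{v}) :
      WithTop EnrichedUA.RegularCardinal.{v}) ≤ kap) :
    (∀ X : V, Nonempty (EnrichedUA.FreeStr L X)) ∧
    ∀ (F : ∀ X : V, EnrichedUA.FreeStr L X) (P : ObjectProperty (EnrichedUA.Str L)),
      ((∃ E : Set (EnrichedUA.Equation F),
          EnrichedUA.IsAryTheory kap E ∧ P = EnrichedUA.Mod E) ↔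
        ∃ H : Set (EnrichedUA.FreeArrow F),
          EnrichedUA.IsAryRegularEpiCollection kap H ∧ P = EnrichedUA.OrthogonalityClass H) ∧
      ((∃ E : Set (EnrichedUA.Equation F), Small.{v} E ∧
          EnrichedUA.IsAryTheory kap E ∧ P = EnrichedUA.Mod E) ↔
        ∃ H : Set (EnrichedUA.FreeArrow F), Small.{v} H ∧
          EnrichedUA.IsAryRegularEpiCollection kap H ∧ P = EnrichedUA.OrthogonalityClass H) ∧
      (kap ≠ ⊤ →
        ((∃ E : Set (EnrichedUA.Equation F), Small.{v} E ∧
            EnrichedUA.IsAryTheory kap E ∧ P = EnrichedUA.Mod E) ↔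
          ∃ H : Set (EnrichedUA.FreeArrow F),
            EnrichedUA.IsAryRegularEpiCollection kap H ∧
              P = EnrichedUA.OrthogonalityClass H)) := by
  refine ⟨EnrichedUA.nonempty_freeStr L, fun F P => ⟨⟨?_, ?_⟩, ⟨?_, ?_⟩, fun hkap' => ⟨?_, ?_⟩⟩⟩
  · rintro ⟨E, hE, rfl⟩
    obtain ⟨H, -, hH, e⟩ := EnrichedUA.exists_orthogonalityClass_eq_mod hE
    exact ⟨H, hH, e⟩
  · rintro ⟨H, hH, rfl⟩
    obtain ⟨E, -, hE, e⟩ := EnrichedUA.exists_mod_eq_orthogonalityClass hkap hH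
    exact ⟨E, hE, e⟩
  · rintro ⟨E, hs, hE, rfl⟩
    obtain ⟨H, hs', hH, e⟩ := EnrichedUA.exists_orthogonalityClass_eq_mod hE
    exact ⟨H, hs' hs, hH, e⟩
  · rintro ⟨H, hs, hH, rfl⟩
    obtain ⟨E, hs', hE, e⟩ := EnrichedUA.exists_mod_eq_orthogonalityClass hkap hH
    exact ⟨E, hs' hs, hE, e⟩
  · rintro ⟨E, -, hE, rfl⟩
    obtain ⟨H, -, hH, e⟩ := EnrichedUA.exists_orthogonalityClass_eq_mod hE
    exact ⟨H, hH, e⟩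
  · rintro ⟨H, hH, rfl⟩
    obtain ⟨E, -, hE, e⟩ := EnrichedUA.exists_mod_eq_orthogonalityClass hkap hH
    obtain ⟨E', hs, hE', e'⟩ := EnrichedUA.exists_small_mod_eq hkap hkap' hE
    exact ⟨E', hs, hE', e.trans e'⟩
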